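/- **Setting.** Let $V$ be a finite set, let $V_1,\dots,V_R\subseteq V$ be sets with $\bigcup_i V_i=V$, and for each $i$ let $F_i:2^{V_i}\to\mathbb R$ be submodular with $F_i(\emptyset)=0$. Put $F(A)=\sum_i F_i(A\cap V_i)$ for $A\subseteq V$. For $G:2^U\to\mathbb R$ let $B(G)=\{s\in\mathbb R^U: s(A)\le G(A)\ \forall A\subseteq U,\ s(U)=G(U)\}$, where $s(A)=\sum_{v\in A}s_v$. The factor graph joins factor $i$ to $v$ iff $v\in V_i$; $\delta(v)$ is the set of factors adjacent to $v$, and $E=\sum_i|V_i|$ is the number of edges. For a stacked vector $y=(y_i)_i\in\prod_i\mathbb R^{V_i}$ let $\Sigma y\in\mathbb R^V$ be the vector $(\Sigma y)_v=\sum_{i\in\delta(v)}y_{i,v}$. Let $\mathcal B=\prod_i B(F_i)$ and $\Lambda=\{\lambda\in\prod_i\mathbb R^{V_i}:\Sigma\lambda=0\}$, and for $x\in\mathbb R^{V_i}$ let $\|x\|_{G*}^2=\sum_{v\in V_i}|\delta(v)|x_v^2$. All other norms without subscript are Euclidean. The *min-norm point* is the minimizer $s^*$ of $\|s\|^2$ over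 $B(F)$; a vector $y\in\mathcal B$ is *optimal* if it minimizes $\|\Sigma y\|^2$ over $\mathcal B$. **Algorithm.** Start from $q^0\in\mathcal B$. In round $t$ each factor $i$ sends $q^t_{i,v}$ to each $v\in V_i$, each variable $v$ replies with the mean $m^t_v=\frac1{|\delta(v)|}\sum_{i\in\delta(v)}q^t_{i,v}$, and all factors simultaneously set $$q_i^{t+1}=\operatorname*{argmin}_{p\in B(F_i)}\ \|p-(q_i^t-m^t|_{V_i})\|_{G*}^2 .$$ **Theorem.** Suppose that every variable lies in exactly $\Delta_V$ of the sets $V_i$. Then: 1. For every $q^0\in\mathcal B$ the algorithm defines exactly one sequence $(q^t)_{t\ge0}$. 2. A sequence $(q^t)$ is a run of the algorithm if and only if, together with some sequence $(\lambda^t)$ in $\Lambda$, it is a run of block coordinate descent on the decomposed dual $$\max_{\lambda\in\Lambda,\ y\in\mathcal B}\ \sum_i-\tfrac12\|y_i-\lambda_i\|_{G*}^2 ,$$ that is, $q^t\in\mathcal B$ for all $t$, $\lambda^t$ maximizes the objective over $\Lambda$ for fixed $y=q^t$, and $q^{t+1}$ maximizes it over $\mathcal B$ for fixed $\lambda=\lambda^t$.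 3. The min-norm point $s^*$ exists and is unique, and $\Sigma y=s^*$ for every optimal $y$. 4. For every run, $q^t$ converges to an optimal stacked vector $q^*$ (which may depend on $q^0$), and for all $t\ge0$ $$\|q^t-q^*\|\le 2\,\|q^0-q^*\|_\infty\sqrt{\Delta_V E}\,\Bigl(1-\frac1{|V|^2\Delta_V^2}\Bigr)^t .$$ 5. For every run the approximations $\Sigma q^t$ converge linearly to the min-norm point: for every optimal stacked vector $y$ (in particular for $y=q^*$) and all $t\ge0$ $$\|\Sigma q^t-s^*\|\le 2\,\|q^0-y\|_\infty\sqrt{\Delta_V E}\,\Bigl(1-\frac1{|V|^2\Delta_V^2}\Bigr)^t .$$ -/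

import Mathlib

open Filter Topology

/-- Diminishing returns: the gain of adding `x` decreases as the context grows. -/
def IsSubmodular {α : Type*} [DecidableEq α] (F : Finset α → ℝ) : Prop :=
  ∀ A B : Finset α, A ⊆ B → ∀ x, x ∉ B → F (insert x B) - F B ≤ F (insert x A) - F A

/-- The base polytope `B(F) = {s | s(A) ≤ F(A) for all A, and s(ground set) = F(ground set)}`. -/
def basePolytope {α : Type*} [Fintype α] (F : Finset α → ℝ) : Set (α → ℝ) :=
  {s | (∀ A : Finset α, ∑ v ∈ A, s v ≤ F A) ∧ ∑ v, s v = F Finset.univ}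

/-- A family of normalized submodular functions `F i : 2 ^ (scope i) → ℝ`, indexed by the factors
`i : ι`, whose ground sets `scope i` cover the set `V` of variables. -/
structure FactorModel (V ι : Type*) [DecidableEq V] where
  scope : ι → Finset V
  F : (i : ι) → Finset (scope i) → ℝ
  normalized : ∀ i, F i ∅ = 0
  submodular : ∀ i, IsSubmodular (F i)
  cover : ∀ v, ∃ i, v ∈ scope i

namespace FactorModel

variable {V ι : Type*} [Fintype V] [DecidableEq V] [Fintype ι] (M : FactorModel V ι)

/-- The sum `A ↦ ∑ i, F i (A ∩ scope i)`. -/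
def total (A : Finset V) : ℝ := ∑ i, M.F i (A.subtype (· ∈ M.scope i))

/-- The factors adjacent to a variable in the factor graph, `δ(v)`. -/
def nbrs (v : V) : Finset ι := Finset.univ.filter fun i => v ∈ M.scope i

/-- The edges of the bipartite factor graph: pairs of a factor and a variable in its scope. -/
abbrev Edge : Type _ := Σ i : ι, {v : V // v ∈ M.scope i}

/-- Stacked vectors `(y_i)_i` with `y_i ∈ ℝ ^ (scope i)`, carrying the Euclidean norm. -/
abbrev EdgeVec : Type _ := EuclideanSpace ℝ M.Edge

/-- The `i`-th block of a stacked vector. -/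
def block (y : M.EdgeVec) (i : ι) : M.scope i → ℝ := fun v => y ⟨i, v⟩

/-- The message from factor `i` to variable `v`: the `v`-coordinate of the vector stored at `i`
(zero if `v` is not in the scope of `i`). -/
def factorMsg (y : M.EdgeVec) (i : ι) (v : V) : ℝ :=
  if h : v ∈ M.scope i then y ⟨i, ⟨v, h⟩⟩ else 0

/-- The message that variable `v` sends to all adjacent factors: the mean of what it receives. -/
noncomputable def varMsg (y : M.EdgeVec) (v : V) : ℝ :=
  (1 / ((M.nbrs v).card : ℝ)) * ∑ i ∈ M.nbrs v, M.factorMsg y i v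

/-- The vector in `ℝ ^ V` whose `v`-coordinate is the sum of the messages arriving at `v`. -/
noncomputable def aggregate (y : M.EdgeVec) : EuclideanSpace ℝ V :=
  WithLp.toLp 2 fun v => ∑ i ∈ M.nbrs v, M.factorMsg y i v

/-- The squared norm `‖x‖²_{G*} = ∑ v, |δ(v)| x_v²` on `ℝ ^ (scope i)`. -/
def gStarSq (i : ι) (x : M.scope i → ℝ) : ℝ :=
  ∑ v : M.scope i, ((M.nbrs (v : V)).card : ℝ) * x v ^ 2

/-- The product of the base polytopes of the factors. -/
def prodBase : Set M.EdgeVec := {y | ∀ i, M.block y i ∈ basePolytope (M.F i)}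

/-- The parallel message-passing algorithm. Each factor stores a vector of its base polytope. In
every round the factors send its coordinates, the variables answer with the means, and then
all factors simultaneously update
`y_i ← argmin {‖p - (y_i - m_i)‖²_{G*} | p ∈ B(F_i)}`, `m_i` being the vector of messages
received by factor `i`. -/
def IsMessagePassing (q : ℕ → M.EdgeVec) : Prop :=
  (∀ t, q t ∈ M.prodBase) ∧
  ∀ t i, IsMinOn
    (fun p : M.scope i → ℝ =>
      M.gStarSq i (fun v => p v - (M.block (q t) i v - M.varMsg (q t) (v : V))))
    (basePolytope (M.F i)) (M.block (q (t + 1)) i)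

/-- The admissible Lagrange multipliers: at each variable the coordinates sum to zero. -/
def multipliers : Set M.EdgeVec := {l | ∀ v, ∑ i ∈ M.nbrs v, M.factorMsg l i v = 0}

/-- The objective of the decomposed dual problem, to be maximized over `l ∈ multipliers` and
`y ∈ prodBase`. -/
noncomputable def dualObjective (l y : M.EdgeVec) : ℝ :=
  ∑ i, -(1 / 2) * M.gStarSq i (fun v => M.block y i v - M.block l i v)

/-- Block coordinate descent for the decomposed dual: alternate exact maximization over the
multipliers and over the product of base polytopes. -/
def IsBlockCoordinateDescent (l y : ℕ → M.EdgeVec) : Prop :=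
  (∀ t, y t ∈ M.prodBase) ∧ (∀ t, l t ∈ M.multipliers) ∧
  (∀ t, IsMaxOn (fun l' => M.dualObjective l' (y t)) M.multipliers (l t)) ∧
  ∀ t, IsMaxOn (fun y' => M.dualObjective (l t) y') M.prodBase (y (t + 1))

/-- Solutions of the decomposed minimum-norm problem
`minimize ∑ v, (∑ i ∈ δ(v), y_{i,v})²` subject to `y_i ∈ B(F_i)`. -/
def IsOptimal (y : M.EdgeVec) : Prop :=
  y ∈ M.prodBase ∧
  IsMinOn (fun p : M.EdgeVec => ∑ v, (∑ i ∈ M.nbrs v, M.factorMsg p i v) ^ 2) M.prodBase y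

/-- Solutions of the minimum-norm problem over the base polytope of the sum of the factors. -/
def IsMinNormPoint (s : EuclideanSpace ℝ V) : Prop :=
  WithLp.ofLp s ∈ basePolytope M.total ∧
  ∀ s' : EuclideanSpace ℝ V, WithLp.ofLp s' ∈ basePolytope M.total → ‖s‖ ^ 2 ≤ ‖s'‖ ^ 2

/-- The maximum norm of a stacked vector. -/
noncomputable def supNorm (y : M.EdgeVec) : ℝ := ‖(WithLp.ofLp y : M.Edge → ℝ)‖

/-- The number of edges of the factor graph. -/
def numEdges : ℕ := Fintype.card M.Edge

end FactorModel

/-! A round is an alternating projection. If all degrees equal `Δ`, the weighted norms are multiples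
of the Euclidean one, the factor updates together form the Euclidean projection to the product of
base polytopes, and subtracting the means is the orthogonal projection to the multipliers. These
projections are the two exact block maximizations of the dual. If `e` is optimal, then `e` is the
projection of `centered e`; the variational inequalities and Pythagoras give `‖q' - e‖² ≤ ‖q - e‖² -
‖Σ(q - e)‖² / Δ` for one round (`IsProjection.norm_sub_sq_le`).

Linear convergence needs an error bound: for `e` the optimal point nearest to `q`, `‖q - e‖² ≤
|V|²/2 · ‖Σ(q - e)‖²` (`IsOptimal.norm_sub_sq_le`). It is combinatorial. Moves of mass along `q - e`
inside single factors define a relation on the variables. A cycle would be a feasible direction with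
zero aggregate, hence leading to an optimal point, and positively correlated with `q - e`, against
the choice of `e`. Without cycles, the sets of predecessors bound each coordinate of `q - e` by sums
of coordinates of `Σ(q - e)`. The driving fact is that tight sets of a submodular function form a
lattice (`exists_isTight_separating`).

The distance to the optimal set thus decays geometrically. Since the distance to each fixed optimal
point never increases, the iterates form a Cauchy sequence, at the price of a factor 2.

The min-norm point is found without decomposing the base polytope of the sum: at an optimal stacked
vector, the lower level sets of the aggregate are tight in every factor, and summation by parts
gives the optimality condition over that whole polytope. -/

set_option linter.unusedSectionVars false

/-! ### Base polytopes of submodular functions: tight sets and feasible directions -/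

section Submodular

variable {α : Type*} {F : Finset α → ℝ}

section Polytope

variable [Fintype α]

/-- `A` is a tight set of `s` if the constraint of `A` in the base polytope is active at `s`. -/
def IsTight (F : Finset α → ℝ) (s : α → ℝ) (A : Finset α) : Prop := ∑ v ∈ A, s v = F A

/-- The cone of directions in which the base polytope extends from `s`. -/
def IsFeasibleDir (F : Finset α → ℝ) (s z : α → ℝ) : Prop :=
  (∀ A, IsTight F s A → ∑ v ∈ A, z v ≤ 0) ∧ ∑ v, z v = 0

theorem IsFeasibleDir.add {s z z' : α → ℝ} (h : IsFeasibleDir F s z)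
    (h' : IsFeasibleDir F s z') : IsFeasibleDir F s (z + z') := by
  refine ⟨fun A hA => ?_, ?_⟩
  · have := h.1 A hA
    have := h'.1 A hA
    simp only [Pi.add_apply, Finset.sum_add_distrib]
    linarith
  · simp only [Pi.add_apply, Finset.sum_add_distrib, h.2, h'.2, add_zero]

theorem isFeasibleDir_zero (F : Finset α → ℝ) (s : α → ℝ) : IsFeasibleDir F s 0 := by
  simp [IsFeasibleDir]

theorem isFeasibleDir_sub {s y : α → ℝ} (hs : s ∈ basePolytope F) (hy : y ∈ basePolytope F) :
    IsFeasibleDir F s (y - s) := by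
  refine ⟨fun A hA => ?_, ?_⟩
  · have := hy.1 A
    unfold IsTight at hA
    simp only [Pi.sub_apply, Finset.sum_sub_distrib]
    linarith
  · simp only [Pi.sub_apply, Finset.sum_sub_distrib, hy.2, hs.2, sub_self]

/-- Tight constraints survive every positive step by the cone condition, slack ones every small step
by continuity. As there are finitely many constraints, one range of steps serves all. -/
theorem IsFeasibleDir.eventually_mem {s z : α → ℝ} (hs : s ∈ basePolytope F)
    (hz : IsFeasibleDir F s z) : ∀ᶠ ε : ℝ in 𝓝[>] 0, s + ε • z ∈ basePolytope F := by
  have h : ∀ A : Finset α, ∀ᶠ ε : ℝ in 𝓝[>] 0, ∑ v ∈ A, (s + ε • z) v ≤ F A := by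
    intro A
    have hsum : ∀ ε : ℝ, ∑ v ∈ A, (s + ε • z) v = ∑ v ∈ A, s v + ε * ∑ v ∈ A, z v := by
      intro ε
      simp [Finset.sum_add_distrib, Finset.mul_sum]
    simp only [hsum]
    by_cases hA : IsTight F s A
    · filter_upwards [self_mem_nhdsWithin] with ε hε
      have h1 := mul_nonpos_of_nonneg_of_nonpos (le_of_lt (Set.mem_Ioi.1 hε)) (hz.1 A hA)
      have h2 := hs.1 A
      linarith
    · have hlt : ∑ v ∈ A, s v < F A := lt_of_le_of_ne (hs.1 A) hA
      have hc : Tendsto (fun ε : ℝ => ∑ v ∈ A, s v + ε * ∑ v ∈ A, z v) (𝓝 0)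
          (𝓝 (∑ v ∈ A, s v + 0 * ∑ v ∈ A, z v)) :=
        Continuous.tendsto (by fun_prop) 0
      rw [zero_mul, add_zero] at hc
      exact ((hc.eventually (gt_mem_nhds hlt)).filter_mono nhdsWithin_le_nhds).mono
        fun _ h => le_of_lt h
  filter_upwards [eventually_all.2 h] with ε hε
  refine ⟨hε, ?_⟩
  simp [Finset.sum_add_distrib, ← Finset.mul_sum, hz.2, hs.2]

theorem convex_basePolytope (F : Finset α → ℝ) : Convex ℝ (basePolytope F) := by
  intro x hx y hy a b ha hb hab
  have hsum : ∀ A : Finset α, ∑ v ∈ A, (a • x + b • y) v =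
      a * ∑ v ∈ A, x v + b * ∑ v ∈ A, y v := by
    intro A
    simp [Finset.sum_add_distrib, Finset.mul_sum]
  refine ⟨fun A => ?_, ?_⟩
  · rw [hsum]
    have h1 := mul_le_mul_of_nonneg_left (hx.1 A) ha
    have h2 := mul_le_mul_of_nonneg_left (hy.1 A) hb
    have h3 : F A = a * F A + b * F A := by rw [← add_mul, hab, one_mul]
    linarith
  · rw [hsum, hx.2, hy.2, ← add_mul, hab, one_mul]

theorem isClosed_basePolytope (F : Finset α → ℝ) : IsClosed (basePolytope F) := by
  have h : basePolytope F =
      (⋂ A : Finset α, {s | ∑ v ∈ A, s v ≤ F A}) ∩ {s | ∑ v, s v = F Finset.univ} := by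
    ext s
    simp [basePolytope]
  rw [h]
  exact (isClosed_iInter fun A => isClosed_le (by fun_prop) continuous_const).inter
    (isClosed_eq (by fun_prop) continuous_const)

end Polytope

variable [DecidableEq α]

theorem IsSubmodular.union_le (hF : IsSubmodular F) {A B : Finset α} (hAB : A ⊆ B)
    (C : Finset α) (hC : Disjoint C B) : F (B ∪ C) - F B ≤ F (A ∪ C) - F A := by
  induction C using Finset.induction_on with
  | empty => simp
  | insert x C hx ih =>
    rw [Finset.disjoint_insert_left] at hC
    have h1 := ih hC.2
    have h2 := hF (A ∪ C) (B ∪ C) (Finset.union_subset_union_left hAB) x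
      (by simp [hC.1, hx])
    rw [Finset.union_insert, Finset.union_insert]
    linarith

theorem IsSubmodular.union_add_inter_le (hF : IsSubmodular F) (A B : Finset α) :
    F (A ∪ B) + F (A ∩ B) ≤ F A + F B := by
  have h := hF.union_le (A := A ∩ B) (B := A) Finset.inter_subset_left (B \ A)
    Finset.sdiff_disjoint
  have h1 : A ∪ B \ A = A ∪ B := by ext; simp
  have h2 : A ∩ B ∪ B \ A = B := by ext x; by_cases x ∈ A <;> simp [*]
  rw [h1, h2] at h
  linarith

/-- Edmonds' greedy vector: each new element receives its marginal gain, which by diminishing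
returns is at most its gain over any smaller context. -/
theorem IsSubmodular.exists_greedy (hF : IsSubmodular F) (h0 : F ∅ = 0) (S : Finset α) :
    ∃ s : α → ℝ, (∀ A ⊆ S, ∑ v ∈ A, s v ≤ F A) ∧ ∑ v ∈ S, s v = F S := by
  induction S using Finset.induction_on with
  | empty => exact ⟨0, fun A hA => by simp [Finset.subset_empty.1 hA, h0], by simp [h0]⟩
  | insert x S hx ih =>
    obtain ⟨s, hs, hS⟩ := ih
    have key : ∀ B : Finset α, x ∉ B →
        ∑ v ∈ B, Function.update s x (F (insert x S) - F S) v = ∑ v ∈ B, s v := fun B hB =>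
      Finset.sum_congr rfl fun v hv =>
        Function.update_of_ne (ne_of_mem_of_not_mem hv hB) _ _
    refine ⟨Function.update s x (F (insert x S) - F S), fun A hA => ?_, ?_⟩
    · by_cases hxA : x ∈ A
      · have hsub : A.erase x ⊆ S := fun v hv => by
          have := hA (Finset.mem_of_mem_erase hv)
          exact (Finset.mem_insert.1 this).resolve_left (Finset.ne_of_mem_erase hv)
        have h1 := hF _ _ hsub x hx
        have h2 := hs _ hsub
        rw [Finset.insert_erase hxA] at h1
        rw [← Finset.add_sum_erase _ _ hxA, key _ (Finset.notMem_erase x A),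
          Function.update_self]
        linarith
      · rw [key _ hxA]
        exact hs _ fun v hv =>
          (Finset.mem_insert.1 (hA hv)).resolve_left (ne_of_mem_of_not_mem hv hxA)
    · rw [Finset.sum_insert hx, key _ hx, Function.update_self, hS]
      ring

variable [Fintype α]

theorem IsSubmodular.basePolytope_nonempty (hF : IsSubmodular F) (h0 : F ∅ = 0) :
    (basePolytope F).Nonempty := by
  obtain ⟨s, h1, h2⟩ := hF.exists_greedy h0 Finset.univ
  exact ⟨s, fun A => h1 A (Finset.subset_univ A), h2⟩

/-- The modular `s` lies below the submodular `F`, so equality at `A` and `B` leaves no slack at the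
union and the intersection. -/
theorem IsTight.union_inter {s : α → ℝ} (hF : IsSubmodular F) (hs : s ∈ basePolytope F)
    {A B : Finset α} (hA : IsTight F s A) (hB : IsTight F s B) :
    IsTight F s (A ∪ B) ∧ IsTight F s (A ∩ B) := by
  have h1 := hF.union_add_inter_le A B
  have h2 := Finset.sum_union_inter (s₁ := A) (s₂ := B) (f := s)
  have h3 := hs.1 (A ∪ B)
  have h4 := hs.1 (A ∩ B)
  unfold IsTight at *
  constructor <;> linarith

/-- If every element of `S` is separated from every element of `N` by a tight set, then a single
tight set separates `S` from `N`. -/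
theorem exists_isTight_separating {s : α → ℝ} (hF : IsSubmodular F) (h0 : F ∅ = 0)
    (hs : s ∈ basePolytope F) (S N : Finset α)
    (h : ∀ u ∈ S, ∀ w ∈ N, ∃ A, IsTight F s A ∧ u ∈ A ∧ w ∉ A) :
    ∃ D, IsTight F s D ∧ S ⊆ D ∧ ∀ w ∈ N, w ∉ D := by
  classical
  have hsep : ∀ u ∈ S, ∃ A, IsTight F s A ∧ u ∈ A ∧ ∀ w ∈ N, w ∉ A := by
    intro u hu
    choose! f hf using h u hu
    -- Intersect over `w` for fixed `u`, then unite over `u`. The empty intersection is the ground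
    -- set and the empty union is `∅`; both are tight, the latter because `F ∅ = 0`.
    refine ⟨N.inf f, ?_, ?_, fun w hw hmem => (hf w hw).2.2 ?_⟩
    · exact Finset.inf_induction hs.2 (fun A hA B hB => (hA.union_inter hF hs hB).2)
        fun w hw => (hf w hw).1
    · exact Finset.mem_inf.2 fun w hw => (hf w hw).2.1
    · exact Finset.mem_inf.1 hmem w hw
  choose! f hf using hsep
  refine ⟨S.sup f, ?_, fun u hu => ?_, fun w hw hmem => ?_⟩
  · exact Finset.sup_induction (p := IsTight F s) (by simp [IsTight, h0])
      (fun A hA B hB => (hA.union_inter hF hs hB).1) fun u hu => (hf u hu).1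
  · exact Finset.mem_sup.2 ⟨u, hu, (hf u hu).2.1⟩
  · obtain ⟨u, hu, hwu⟩ := Finset.mem_sup.1 hmem
    exact (hf u hu).2.2 w hw hwu

/-- Raising `u` at the expense of `w` is harmless when every tight set that sees the gain also sees
the loss. -/
theorem isFeasibleDir_exchange {s : α → ℝ} {u w : α}
    (h : ∀ A, IsTight F s A → u ∈ A → w ∈ A) :
    IsFeasibleDir F s (Pi.single u 1 - Pi.single w 1) := by
  refine ⟨fun A hA => ?_, by simp⟩
  have := h A hA
  simp only [Pi.sub_apply, Finset.sum_sub_distrib]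
  by_cases hu : u ∈ A
  · simp [hu, this hu]
  · by_cases hw : w ∈ A <;> simp [hu, hw]

/-- The bounding box that makes the product of base polytopes compact. -/
theorem mem_Icc_of_mem_basePolytope {s : α → ℝ} (hs : s ∈ basePolytope F) (v : α) :
    s v ∈ Set.Icc (F Finset.univ - F (Finset.univ.erase v)) (F {v}) := by
  have h1 := hs.1 {v}
  have h2 := hs.1 (Finset.univ.erase v)
  have h3 := Finset.add_sum_erase Finset.univ s (Finset.mem_univ v)
  rw [hs.2] at h3
  rw [Finset.sum_singleton] at h1
  exact ⟨by linarith, h1⟩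

end Submodular

/-! ### Summation by parts and nearest points of convex sets -/

/-- Summation by parts: a weight whose strict lower level sums with respect to `h` are nonpositive
has nonpositive sum against every nonnegative shift of `-h`. -/
theorem sum_mul_sub_nonpos {β : Type*} (h g : β → ℝ) (S : Finset β) :
    (∀ c, ∑ v ∈ S with h v < c, g v ≤ 0) → ∀ m, (∀ v ∈ S, h v ≤ m) →
      ∑ v ∈ S, (m - h v) * g v ≤ 0 := by
  induction S using Finset.strongInduction with
  | H S ih =>
    intro hc m hm
    rcases S.eq_empty_or_nonempty with rfl | hne
    · simp
    obtain ⟨a, ha, hmax⟩ := S.exists_max_image h hne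
    -- With `m` equal to the maximum, the elements attaining it contribute zero, so induction
    -- applies to the elements strictly below. Their level sets are level sets of `S` at the level
    -- `min (h a) c`.
    have h1 : ∑ v ∈ S, (h a - h v) * g v ≤ 0 := by
      have h2 := ih {v ∈ S | h v < h a}
        (Finset.filter_ssubset.2 ⟨a, ha, lt_irrefl _⟩) (fun c => by
          have := hc (min (h a) c)
          simpa only [Finset.filter_filter, lt_min_iff] using this) (h a)
        fun v hv => (Finset.mem_filter.1 hv).2.le
      rwa [Finset.sum_filter_of_ne] at h2
      intro v hv hne
      refine lt_of_le_of_ne (hmax v hv) fun heq => hne ?_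
      rw [heq, sub_self, zero_mul]
    have h3 : ∑ v ∈ S, g v ≤ 0 := by
      have := hc (h a + 1)
      rwa [Finset.filter_true_of_mem fun v hv => by linarith [hmax v hv]] at this
    have h4 : ∑ v ∈ S, (m - h v) * g v =
        ∑ v ∈ S, (h a - h v) * g v + (m - h a) * ∑ v ∈ S, g v := by
      rw [Finset.mul_sum, ← Finset.sum_add_distrib]
      exact Finset.sum_congr rfl fun v _ => by ring
    have h5 := mul_nonpos_of_nonneg_of_nonpos (sub_nonneg.2 (hm a ha)) h3
    linarith

/-- Variational inequality for the nearest point of a convex set. -/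
theorem inner_sub_nonpos_of_forall_norm_le {X : Type*} [NormedAddCommGroup X]
    [InnerProductSpace ℝ X] {K : Set X} (hK : Convex ℝ K) {x q : X} (hq : q ∈ K)
    (h : ∀ p ∈ K, ‖q - x‖ ≤ ‖p - x‖) {y : X} (hy : y ∈ K) : inner ℝ (x - q) (y - q) ≤ 0 := by
  refine (norm_eq_iInf_iff_real_inner_le_zero hK hq).1 ?_ y hy
  have : Nonempty K := ⟨⟨q, hq⟩⟩
  refine le_antisymm (le_ciInf fun w => ?_) ?_
  · rw [norm_sub_rev x q, norm_sub_rev x w]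
    exact h w w.2
  · exact ciInf_le (f := fun w : K => ‖x - w‖) ⟨0, by rintro _ ⟨w, rfl⟩; exact norm_nonneg _⟩
      ⟨q, hq⟩

/-- Test the variational inequality of each minimizer at the other one and add. -/
theorem eq_of_forall_norm_le {X : Type*} [NormedAddCommGroup X]
    [InnerProductSpace ℝ X] {K : Set X} (hK : Convex ℝ K) {x q q' : X} (hq : q ∈ K) (hq' : q' ∈ K)
    (h : ∀ p ∈ K, ‖q - x‖ ≤ ‖p - x‖) (h' : ∀ p ∈ K, ‖q' - x‖ ≤ ‖p - x‖) : q = q' := by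
  have h1 := inner_sub_nonpos_of_forall_norm_le hK hq h hq'
  have h2 := inner_sub_nonpos_of_forall_norm_le hK hq' h' hq
  have h3 : inner ℝ (q' - q) (q' - q) = inner ℝ (x - q) (q' - q) + inner ℝ (x - q') (q - q') := by
    rw [← neg_sub q' q, inner_neg_right, ← sub_eq_add_neg, ← inner_sub_left]
    congr 1
    abel
  have h4 : inner ℝ (q' - q) (q' - q) ≤ 0 := by linarith
  exact (sub_eq_zero.1 (real_inner_self_nonpos.1 h4)).symm

/-! ### Stacked vectors, aggregation and its adjoint -/

namespace FactorModel

variable {V ι : Type*} [Fintype V] [DecidableEq V] [Fintype ι] (M : FactorModel V ι)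

theorem sum_factorMsg_eq (y : M.EdgeVec) (v : V) :
    ∑ i ∈ M.nbrs v, M.factorMsg y i v = ∑ i, M.factorMsg y i v := by
  refine Finset.sum_subset (Finset.subset_univ _) fun i _ hi => dif_neg ?_
  simpa [nbrs] using hi

theorem sum_subtype_scope (y : M.EdgeVec) (i : ι) (A : Finset V) :
    ∑ v ∈ A.subtype (· ∈ M.scope i), M.block y i v = ∑ v ∈ A, M.factorMsg y i v := by
  have h : ∀ v : M.scope i, M.block y i v = M.factorMsg y i (v : V) := fun v => by
    simp [block, factorMsg]
  simp only [h]
  rw [Finset.sum_subtype_eq_sum_filter, Finset.sum_filter_of_ne]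
  intro v _ hne
  by_contra hv
  exact hne (dif_neg hv)

theorem sum_scope (y : M.EdgeVec) (i : ι) (a : V → ℝ) :
    ∑ v : M.scope i, a v * M.block y i v = ∑ v, a v * M.factorMsg y i v := by
  have h : ∀ v : M.scope i, a v * M.block y i v = a v * M.factorMsg y i (v : V) := fun v => by
    simp [block, factorMsg]
  simp only [h]
  rw [Finset.sum_coe_sort (M.scope i) fun v => a v * M.factorMsg y i v]
  refine Finset.sum_subset (Finset.subset_univ _) fun v _ hv => ?_
  rw [factorMsg, dif_neg hv, mul_zero]

/-- The stacked vector all of whose blocks are restrictions of `a`. -/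
def lift (a : EuclideanSpace ℝ V) : M.EdgeVec := WithLp.toLp 2 fun e => a e.2

/-- `lift` is the adjoint of `aggregate`. Linearity of `aggregate` and its values on unit vectors
follow by testing against every `a`. -/
theorem inner_lift (a : EuclideanSpace ℝ V) (y : M.EdgeVec) :
    inner ℝ (M.lift a) y = inner ℝ a (M.aggregate y) := by
  have h : inner ℝ (M.lift a) y = ∑ i, ∑ v : M.scope i, a v * M.block y i v := by
    rw [PiLp.inner_apply, Fintype.sum_sigma]
    simp [lift, block, mul_comm]
  rw [h, PiLp.inner_apply]
  simp only [sum_scope, aggregate, sum_factorMsg_eq]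
  rw [Finset.sum_comm]
  simp [Finset.mul_sum, mul_comm]

theorem aggregate_add (y z : M.EdgeVec) : M.aggregate (y + z) = M.aggregate y + M.aggregate z :=
  ext_inner_left ℝ fun a => by simp only [inner_add_right, ← inner_lift]

theorem aggregate_sub (y z : M.EdgeVec) : M.aggregate (y - z) = M.aggregate y - M.aggregate z :=
  ext_inner_left ℝ fun a => by simp only [inner_sub_right, ← inner_lift]

theorem aggregate_smul (c : ℝ) (y : M.EdgeVec) : M.aggregate (c • y) = c • M.aggregate y :=
  ext_inner_left ℝ fun a => by simp only [inner_smul_right, ← inner_lift]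

/-- `aggregate` as a linear map. -/
noncomputable def aggregateLin : M.EdgeVec →ₗ[ℝ] EuclideanSpace ℝ V where
  toFun := M.aggregate
  map_add' := M.aggregate_add
  map_smul' := M.aggregate_smul

theorem continuous_aggregate : Continuous M.aggregate :=
  M.aggregateLin.continuous_of_finiteDimensional

theorem lift_sub (a b : EuclideanSpace ℝ V) : M.lift (a - b) = M.lift a - M.lift b := rfl

theorem lift_smul (c : ℝ) (a : EuclideanSpace ℝ V) : M.lift (c • a) = c • M.lift a := rfl

theorem aggregate_single [DecidableEq M.Edge] (i : ι) (v : M.scope i) :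
    M.aggregate (EuclideanSpace.single ⟨i, v⟩ 1) = EuclideanSpace.single (v : V) 1 :=
  ext_inner_left ℝ fun a => by
    rw [← inner_lift, EuclideanSpace.inner_single_right, EuclideanSpace.inner_single_right]
    rfl

variable {M} in
theorem mem_multipliers {l : M.EdgeVec} : l ∈ M.multipliers ↔ M.aggregate l = 0 := by
  rw [PiLp.ext_iff]
  rfl

theorem sum_sq_aggregate (y : M.EdgeVec) :
    ∑ v, (∑ i ∈ M.nbrs v, M.factorMsg y i v) ^ 2 = ‖M.aggregate y‖ ^ 2 := by
  rw [EuclideanSpace.real_norm_sq_eq]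
  rfl

/-- The stacked vector with blocks `y_i - m_i`, where `m` are the variable messages of `y`. -/
noncomputable def centered (y : M.EdgeVec) : M.EdgeVec :=
  y - M.lift (WithLp.toLp 2 (M.varMsg y))

section Regular

variable {M} {Δ : ℕ}

/-- Equal degrees make aggregation a scaled coisometry, which turns centering into an orthogonal
projection in the unweighted norm. -/
theorem aggregate_lift (hreg : ∀ v, (M.nbrs v).card = Δ) (a : EuclideanSpace ℝ V) :
    M.aggregate (M.lift a) = (Δ : ℝ) • a := by
  ext v
  have h : ∀ i ∈ M.nbrs v, M.factorMsg (M.lift a) i v = a v := fun i hi => by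
    have hi' : v ∈ M.scope i := by simpa [nbrs] using hi
    simp [factorMsg, hi', lift]
  simp [aggregate, Finset.sum_congr rfl h, hreg]

theorem centered_eq (hreg : ∀ v, (M.nbrs v).card = Δ) (y : M.EdgeVec) :
    M.centered y = y - (Δ : ℝ)⁻¹ • M.lift (M.aggregate y) := by
  rw [centered, ← lift_smul]
  congr 2
  ext v
  simp [varMsg, aggregate, hreg]

theorem aggregate_centered (hreg : ∀ v, (M.nbrs v).card = Δ) (hΔ : 0 < Δ) (y : M.EdgeVec) :
    M.aggregate (M.centered y) = 0 := by
  have : (Δ : ℝ) ≠ 0 := by positivity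
  rw [centered_eq hreg, aggregate_sub, aggregate_smul, aggregate_lift hreg, smul_smul,
    inv_mul_cancel₀ this, one_smul, sub_self]

theorem centered_sub (hreg : ∀ v, (M.nbrs v).card = Δ) (y z : M.EdgeVec) :
    M.centered (y - z) = M.centered y - M.centered z := by
  simp only [centered_eq hreg, aggregate_sub, lift_sub, smul_sub]
  abel

/-- `centered y` is the orthogonal projection of `y` to the space of multipliers. -/
theorem norm_sub_sq_of_mem_multipliers (hreg : ∀ v, (M.nbrs v).card = Δ) (hΔ : 0 < Δ)
    (y : M.EdgeVec) {l : M.EdgeVec} (hl : l ∈ M.multipliers) :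
    ‖y - l‖ ^ 2 = ‖M.aggregate y‖ ^ 2 / Δ + ‖M.centered y - l‖ ^ 2 := by
  have hΔ' : (Δ : ℝ) ≠ 0 := by positivity
  have h1 : y - l = (Δ : ℝ)⁻¹ • M.lift (M.aggregate y) + (M.centered y - l) := by
    rw [centered_eq hreg]
    abel
  rw [h1, norm_add_sq_real, real_inner_smul_left, inner_lift, aggregate_sub,
    aggregate_centered hreg hΔ, mem_multipliers.1 hl, sub_zero, inner_zero_right, mul_zero,
    mul_zero, add_zero, norm_smul, mul_pow, ← real_inner_self_eq_norm_sq (M.lift _), inner_lift,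
    aggregate_lift hreg, real_inner_smul_right, real_inner_self_eq_norm_sq]
  congr 1
  simp only [norm_inv, Real.norm_natCast]
  field_simp

theorem norm_sq_eq_centered (hreg : ∀ v, (M.nbrs v).card = Δ) (hΔ : 0 < Δ) (y : M.EdgeVec) :
    ‖y‖ ^ 2 = ‖M.aggregate y‖ ^ 2 / Δ + ‖M.centered y‖ ^ 2 := by
  have h : (0 : M.EdgeVec) ∈ M.multipliers := mem_multipliers.2 M.aggregateLin.map_zero
  simpa using norm_sub_sq_of_mem_multipliers hreg hΔ y h

theorem norm_aggregate_le (hreg : ∀ v, (M.nbrs v).card = Δ) (hΔ : 0 < Δ) (y : M.EdgeVec) :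
    ‖M.aggregate y‖ ≤ Real.sqrt Δ * ‖y‖ := by
  have h := norm_sq_eq_centered hreg hΔ y
  have hΔ' : (0 : ℝ) < Δ := by positivity
  refine le_of_sq_le_sq ?_ (by positivity)
  rw [mul_pow, Real.sq_sqrt hΔ'.le, h, mul_add, mul_div_cancel₀ _ hΔ'.ne']
  have := mul_nonneg hΔ'.le (sq_nonneg ‖M.centered y‖)
  linarith

theorem gStarSq_eq (hreg : ∀ v, (M.nbrs v).card = Δ) (i : ι) (x : M.scope i → ℝ) :
    M.gStarSq i x = Δ * ∑ v, x v ^ 2 := by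
  simp [gStarSq, hreg, Finset.mul_sum]

theorem sum_gStarSq_block (hreg : ∀ v, (M.nbrs v).card = Δ) (y : M.EdgeVec) :
    ∑ i, M.gStarSq i (M.block y i) = Δ * ‖y‖ ^ 2 := by
  simp only [gStarSq_eq hreg, EuclideanSpace.real_norm_sq_eq, Fintype.sum_sigma, Finset.mul_sum]
  rfl

theorem dualObjective_eq (hreg : ∀ v, (M.nbrs v).card = Δ) (l y : M.EdgeVec) :
    M.dualObjective l y = -(1 / 2) * (Δ * ‖y - l‖ ^ 2) := by
  rw [← sum_gStarSq_block hreg, Finset.mul_sum]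
  rfl

end Regular

/-! ### The set of optimal stacked vectors -/

theorem convex_prodBase : Convex ℝ M.prodBase := fun _ hx _ hy _ _ ha hb hab i =>
  convex_basePolytope (M.F i) (hx i) (hy i) ha hb hab

theorem isClosed_prodBase : IsClosed M.prodBase := by
  have h : M.prodBase = ⋂ i, (fun y => M.block y i) ⁻¹' basePolytope (M.F i) := by
    ext y
    simp [prodBase]
  rw [h]
  refine isClosed_iInter fun i => (isClosed_basePolytope (M.F i)).preimage ?_
  unfold block
  fun_prop

theorem isCompact_prodBase : IsCompact M.prodBase := by
  classical
  have h := (isCompact_univ_pi fun e : M.Edge => isCompact_Icc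
    (a := M.F e.1 Finset.univ - M.F e.1 (Finset.univ.erase e.2)) (b := M.F e.1 {e.2})).image
    (PiLp.continuous_toLp 2 fun _ : M.Edge => ℝ)
  refine h.of_isClosed_subset M.isClosed_prodBase fun y hy => ⟨WithLp.ofLp y, ?_, rfl⟩
  exact fun e _ => mem_Icc_of_mem_basePolytope (hy e.1) e.2

theorem prodBase_nonempty : M.prodBase.Nonempty := by
  choose s hs using fun i => (M.submodular i).basePolytope_nonempty (M.normalized i)
  exact ⟨WithLp.toLp 2 fun e => s e.1 e.2, hs⟩

theorem exists_isOptimal : ∃ p, M.IsOptimal p :=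
  M.isCompact_prodBase.exists_isMinOn M.prodBase_nonempty (by
    simp only [sum_sq_aggregate]
    exact (M.continuous_aggregate.norm.pow 2).continuousOn)

variable {M}

/-- First-order optimality: the aggregate of `p` is the point nearest to the origin in the convex
image of `prodBase`. -/
theorem IsOptimal.inner_nonneg {p y : M.EdgeVec} (hp : M.IsOptimal p) (hy : y ∈ M.prodBase) :
    0 ≤ inner ℝ (M.aggregate p) (M.aggregate (y - p)) := by
  have hK : Convex ℝ (M.aggregate '' M.prodBase) :=
    M.convex_prodBase.linear_image M.aggregateLin
  have h := inner_sub_nonpos_of_forall_norm_le hK (x := 0) (Set.mem_image_of_mem _ hp.1)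
    (by
      rintro _ ⟨z, hz, rfl⟩
      have h1 := hp.2 hz
      simp only [sum_sq_aggregate, Set.mem_ofPred_eq] at h1
      simpa using le_of_sq_le_sq h1 (norm_nonneg _)) (Set.mem_image_of_mem _ hy)
  rw [zero_sub, inner_neg_left, ← aggregate_sub] at h
  linarith

theorem IsOptimal.of_aggregate_eq {p y : M.EdgeVec} (hp : M.IsOptimal p) (hy : y ∈ M.prodBase)
    (h : M.aggregate y = M.aggregate p) : M.IsOptimal y := by
  refine ⟨hy, fun z hz => ?_⟩
  have := hp.2 hz
  simp only [sum_sq_aggregate, Set.mem_ofPred_eq] at this ⊢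
  rwa [h]

theorem IsOptimal.aggregate_eq {p y : M.EdgeVec} (hp : M.IsOptimal p) (hy : M.IsOptimal y) :
    M.aggregate y = M.aggregate p := by
  have h1 := hp.inner_nonneg hy.1
  have h2 := hy.inner_nonneg hp.1
  have h3 : inner ℝ (M.aggregate y - M.aggregate p) (M.aggregate y - M.aggregate p) ≤ 0 := by
    simp only [aggregate_sub, inner_sub_right, inner_sub_left] at h1 h2 ⊢
    linarith
  exact sub_eq_zero.1 (real_inner_self_nonpos.1 h3)

/-- All optimal vectors share one aggregate, so they form a fibre of `aggregate` in `prodBase`. -/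
theorem isClosed_setOf_isOptimal : IsClosed {p | M.IsOptimal p} := by
  obtain ⟨p, hp⟩ := M.exists_isOptimal
  have h : {p | M.IsOptimal p} = M.prodBase ∩ {y | M.aggregate y = M.aggregate p} := by
    ext y
    exact ⟨fun hy => ⟨hy.1, hp.aggregate_eq hy⟩, fun hy => hp.of_aggregate_eq hy.1 hy.2⟩
  rw [h]
  exact M.isClosed_prodBase.inter (isClosed_eq M.continuous_aggregate continuous_const)

theorem convex_setOf_isOptimal : Convex ℝ {p | M.IsOptimal p} := by
  intro p hp y hy a b ha hb hab
  refine IsOptimal.of_aggregate_eq hp (M.convex_prodBase hp.1 hy.1 ha hb hab) ?_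
  rw [aggregate_add, aggregate_smul, aggregate_smul, IsOptimal.aggregate_eq hp hy, ← add_smul,
    hab, one_smul]

end FactorModel

/-- The sums over `T` and its complement are opposite, and their absolute values add up to at most
the total; hence the half. -/
theorem neg_sum_le_half_sum_abs {β : Type*} [Fintype β] (d : β → ℝ) (hd : ∑ v, d v = 0)
    (T : Finset β) : -∑ v ∈ T, d v ≤ (∑ v, |d v|) / 2 := by
  classical
  have h1 := Finset.sum_add_sum_compl T d
  have h2 := Finset.sum_add_sum_compl T fun v => |d v|
  have h3 := (neg_le_abs _).trans (Finset.abs_sum_le_sum_abs d T)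
  have h4 := (le_abs_self _).trans (Finset.abs_sum_le_sum_abs d Tᶜ)
  linarith

/-! ### Feasible exchanges and the min-norm point -/

namespace FactorModel

variable {V ι : Type*} [Fintype V] [DecidableEq V] [Fintype ι] {M : FactorModel V ι}

theorem sum_aggregate (y : M.EdgeVec) (A : Finset V) :
    ∑ v ∈ A, M.aggregate y v = ∑ i, ∑ v ∈ A.subtype (· ∈ M.scope i), M.block y i v := by
  simp only [sum_subtype_scope, aggregate, sum_factorMsg_eq]
  exact Finset.sum_comm

theorem aggregate_mem_basePolytope {y : M.EdgeVec} (hy : y ∈ M.prodBase) :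
    WithLp.ofLp (M.aggregate y) ∈ basePolytope M.total := by
  refine ⟨fun A => ?_, ?_⟩
  · rw [sum_aggregate]
    exact Finset.sum_le_sum fun i _ => (hy i).1 _
  · rw [sum_aggregate, total]
    refine Finset.sum_congr rfl fun i _ => ?_
    rw [Finset.subtype_univ]
    exact (hy i).2

variable (M) in
/-- The cone of directions in which the product of base polytopes extends from `e`. -/
def IsFeasible (e z : M.EdgeVec) : Prop :=
  ∀ i, IsFeasibleDir (M.F i) (M.block e i) (M.block z i)

theorem IsFeasible.add {e z z' : M.EdgeVec} (h : M.IsFeasible e z) (h' : M.IsFeasible e z') :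
    M.IsFeasible e (z + z') := fun i => (h i).add (h' i)

theorem isFeasible_sub {e y : M.EdgeVec} (he : e ∈ M.prodBase) (hy : y ∈ M.prodBase) :
    M.IsFeasible e (y - e) := fun i =>
  have h : M.block (y - e) i = M.block y i - M.block e i := rfl
  h ▸ isFeasibleDir_sub (he i) (hy i)

theorem IsFeasible.exists_mem {e z : M.EdgeVec} (he : e ∈ M.prodBase) (hz : M.IsFeasible e z) :
    ∃ ε : ℝ, 0 < ε ∧ e + ε • z ∈ M.prodBase := by
  have h : ∀ᶠ ε : ℝ in 𝓝[>] 0, ∀ i, M.block e i + ε • M.block z i ∈ basePolytope (M.F i) :=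
    eventually_all.2 fun i => (hz i).eventually_mem (he i)
  obtain ⟨ε, h1, h2⟩ := (h.and self_mem_nhdsWithin).exists
  exact ⟨ε, h2, h1⟩

theorem isFeasible_exchange [DecidableEq M.Edge] {e : M.EdgeVec} {i : ι} {u w : M.scope i}
    (h : ∀ A, IsTight (M.F i) (M.block e i) A → u ∈ A → w ∈ A) :
    M.IsFeasible e (EuclideanSpace.single ⟨i, u⟩ 1 - EuclideanSpace.single ⟨i, w⟩ 1) := by
  intro j
  by_cases hj : j = i
  · subst hj
    convert isFeasibleDir_exchange h using 1
    ext v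
    simp [block, Pi.single_apply]
  · have h0 : M.block (EuclideanSpace.single ⟨i, u⟩ 1 - EuclideanSpace.single ⟨i, w⟩ 1) j = 0 := by
      ext v
      simp [block, hj]
    rw [h0]
    exact isFeasibleDir_zero _ _

/-- Were some `u` below the level not separable from some `w` above it by a tight set, moving mass
from `w` to `u` would be feasible and would decrease the norm of the aggregate. So a tight set
separates the level set from its complement, and it must be the level set itself. -/
theorem IsOptimal.isTight_lowerLevel {p : M.EdgeVec} (hp : M.IsOptimal p) (i : ι) (c : ℝ) :
    IsTight (M.F i) (M.block p i)
      ((Finset.univ.filter fun v => M.aggregate p v < c).subtype (· ∈ M.scope i)) := by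
  classical
  set S := (Finset.univ.filter fun v => M.aggregate p v < c).subtype (· ∈ M.scope i)
  obtain ⟨D, hD, h1, h2⟩ := exists_isTight_separating (M.submodular i) (M.normalized i) (hp.1 i)
    S Sᶜ (by
      intro u hu w hw
      by_contra! hno
      obtain ⟨ε, hε, hmem⟩ := (isFeasible_exchange hno).exists_mem hp.1
      have h := hp.inner_nonneg hmem
      rw [add_sub_cancel_left, aggregate_smul, aggregate_sub, aggregate_single, aggregate_single,
        real_inner_smul_right, inner_sub_right, EuclideanSpace.inner_single_right,
        EuclideanSpace.inner_single_right] at h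
      have hu' : M.aggregate p u < c := by simpa [S] using hu
      have hw' : c ≤ M.aggregate p w := by simpa [S] using hw
      have h3 := nonneg_of_mul_nonneg_right h hε
      simp at h3
      linarith)
  have : S = D := Finset.Subset.antisymm h1 fun w hw => by
    by_contra hwS
    exact h2 w (Finset.mem_compl.2 hwS) hw
  rwa [this]

theorem IsOptimal.isMinNormPoint {p : M.EdgeVec} (hp : M.IsOptimal p) :
    M.IsMinNormPoint (M.aggregate p) := by
  refine ⟨aggregate_mem_basePolytope hp.1, fun s hs => ?_⟩
  have htot := (aggregate_mem_basePolytope hp.1).2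
  -- Tightness in every factor says that the aggregate attains `total` on its lower level sets,
  -- where `s` cannot exceed it.
  have hlevel : ∀ c, ∑ v with M.aggregate p v < c, (s v - M.aggregate p v) ≤ 0 := by
    intro c
    have h1 := hs.1 (Finset.univ.filter fun v => M.aggregate p v < c)
    rw [Finset.sum_sub_distrib, sum_aggregate p (Finset.univ.filter fun v => M.aggregate p v < c),
      Finset.sum_congr rfl fun i _ => hp.isTight_lowerLevel i c]
    rw [total] at h1
    linarith
  obtain ⟨m, hm⟩ := (Finset.univ.image fun v => M.aggregate p v).exists_le
  have h1 := sum_mul_sub_nonpos (fun v => M.aggregate p v) (fun v => s v - M.aggregate p v)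
    Finset.univ hlevel m fun v hv => hm _ (Finset.mem_image_of_mem _ hv)
  have h2 : ∑ v, (s v - M.aggregate p v) = 0 := by
    rw [Finset.sum_sub_distrib, hs.2, htot, sub_self]
  -- The shift `m` disappears because `s` and the aggregate have equal total sums.
  have h3 : 0 ≤ inner ℝ (M.aggregate p) (s - M.aggregate p) := by
    have h4 : inner ℝ (M.aggregate p) (s - M.aggregate p) =
        ∑ v, M.aggregate p v * (s v - M.aggregate p v) := by
      simp [PiLp.inner_apply, mul_comm]
    simp only [sub_mul, Finset.sum_sub_distrib (f := fun v => m * _), ← Finset.mul_sum, h2] at h1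
    rw [h4]
    linarith
  have h5 : s = M.aggregate p + (s - M.aggregate p) := by abel
  have h6 := norm_add_sq_real (M.aggregate p) (s - M.aggregate p)
  rw [← h5] at h6
  have := sq_nonneg ‖s - M.aggregate p‖
  linarith

theorem IsMinNormPoint.eq {s s' : EuclideanSpace ℝ V} (hs : M.IsMinNormPoint s)
    (hs' : M.IsMinNormPoint s') : s = s' := by
  have hK : Convex ℝ {x : EuclideanSpace ℝ V | WithLp.ofLp x ∈ basePolytope M.total} :=
    fun _ hx _ hy _ _ ha hb hab => convex_basePolytope M.total hx hy ha hb hab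
  refine eq_of_forall_norm_le hK (x := 0) hs.1 hs'.1 (fun p hp => ?_) fun p hp => ?_
  · simpa using le_of_sq_le_sq (hs.2 p hp) (norm_nonneg p)
  · simpa using le_of_sq_le_sq (hs'.2 p hp) (norm_nonneg p)

/-! ### Exchange chains and the error bound -/

variable (M) in
/-- The direction `x` moves mass from `w` to `u` within some factor, compatibly with the
constraints active at `e`. -/
def Transfers (e x : M.EdgeVec) (w u : V) : Prop :=
  ∃ (i : ι) (hw : w ∈ M.scope i) (hu : u ∈ M.scope i), 0 < x ⟨i, ⟨u, hu⟩⟩ ∧ x ⟨i, ⟨w, hw⟩⟩ < 0 ∧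
    ∀ A, IsTight (M.F i) (M.block e i) A → ⟨u, hu⟩ ∈ A → ⟨w, hw⟩ ∈ A

/-- Exchanges along a chain add up: the cone of feasible directions is closed under addition, each
step correlates positively with `x`, and the aggregates telescope. -/
theorem exists_isFeasible_of_transGen {e x : M.EdgeVec} {w v : V}
    (h : Relation.TransGen (M.Transfers e x) w v) :
    ∃ z, M.IsFeasible e z ∧ 0 < inner ℝ x z ∧
      M.aggregate z = EuclideanSpace.single v 1 - EuclideanSpace.single w 1 := by
  classical
  have hstep : ∀ {w u : V}, M.Transfers e x w u → ∃ z, M.IsFeasible e z ∧ 0 < inner ℝ x z ∧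
      M.aggregate z = EuclideanSpace.single u 1 - EuclideanSpace.single w 1 := by
    rintro w u ⟨i, hw, hu, h1, h2, h3⟩
    refine ⟨_, isFeasible_exchange h3, ?_, ?_⟩
    · rw [inner_sub_right, EuclideanSpace.inner_single_right, EuclideanSpace.inner_single_right]
      simp
      linarith
    · rw [aggregate_sub, aggregate_single, aggregate_single]
  induction h with
  | single h => exact hstep h
  | tail _ h ih =>
    obtain ⟨z, h1, h2, h3⟩ := ih
    obtain ⟨z', h1', h2', h3'⟩ := hstep h
    refine ⟨z + z', h1.add h1', ?_, ?_⟩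
    · rw [inner_add_right]
      linarith
    · rw [aggregate_add, h3, h3']
      abel

/-- As no transfer enters `T` from outside, a tight set `D` contains the positive coordinates in `T`
and avoids the negative ones outside. The sum of `x` over `T` in factor `i` is then at most its sum
over `D`, which feasibility makes nonpositive. -/
theorem sum_factorMsg_nonpos_of_closed {e x : M.EdgeVec} (he : e ∈ M.prodBase)
    (hx : M.IsFeasible e x) (T : Finset V) (hT : ∀ w u, u ∈ T → M.Transfers e x w u → w ∈ T)
    (i : ι) : ∑ v ∈ T, M.factorMsg x i v ≤ 0 := by
  classical
  rw [← sum_subtype_scope]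
  set S := T.subtype (· ∈ M.scope i) with hS
  obtain ⟨D, hD, h1, h2⟩ := exists_isTight_separating (M.submodular i) (M.normalized i) (he i)
    {v ∈ S | 0 < M.block x i v} {v ∈ Sᶜ | M.block x i v < 0} (by
      intro u hu w hw
      rw [Finset.mem_filter] at hu hw
      by_contra! hno
      refine Finset.mem_compl.1 hw.1 ?_
      rw [hS, Finset.mem_subtype] at hu ⊢
      exact hT _ _ hu.1 ⟨i, w.2, u.2, hu.2, hw.2, hno⟩)
  refine le_trans ?_ ((hx i).1 D hD)
  have h3 : ∀ A : Finset (M.scope i), ∑ v ∈ A, M.block x i v =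
      ∑ v, if v ∈ A then M.block x i v else 0 := fun A => by
    rw [Finset.sum_ite_mem, Finset.univ_inter]
  rw [h3 S, h3 D]
  refine Finset.sum_le_sum fun v _ => ?_
  by_cases hvS : v ∈ S <;> by_cases hvD : v ∈ D <;> simp only [hvS, hvD, if_true, if_false, le_refl]
  · by_contra! hpos
    exact hvD (h1 (Finset.mem_filter.2 ⟨hvS, hpos⟩))
  · by_contra! hneg
    exact h2 v (Finset.mem_filter.2 ⟨Finset.mem_compl.2 hvS, hneg⟩) hvD

theorem norm_sq_eq_sum_factorMsg (x : M.EdgeVec) : ‖x‖ ^ 2 = ∑ v, ∑ i, M.factorMsg x i v ^ 2 := by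
  rw [EuclideanSpace.real_norm_sq_eq, Fintype.sum_sigma, Finset.sum_comm]
  refine Finset.sum_congr rfl fun i _ => ?_
  have h := M.sum_scope x i (M.factorMsg x i)
  simp only [← pow_two] at h
  rw [← h]
  refine Finset.sum_congr rfl fun v _ => ?_
  simp [factorMsg, block, pow_two]

/-- If no feasible direction with zero aggregate is positively correlated with the feasible
direction `x`, then `x` is controlled by its aggregate. -/
theorem norm_sq_le_of_forall_inner_nonpos {e x : M.EdgeVec} (he : e ∈ M.prodBase)
    (hx : M.IsFeasible e x)
    (hno : ∀ z, M.IsFeasible e z → M.aggregate z = 0 → inner ℝ x z ≤ 0) :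
    ‖x‖ ^ 2 ≤ (Fintype.card V : ℝ) ^ 2 / 2 * ‖M.aggregate x‖ ^ 2 := by
  classical
  set d : V → ℝ := fun v => M.aggregate x v with hd
  set B := (∑ v, |d v|) / 2 with hB
  have hdT : ∀ T : Finset V, ∑ i, ∑ v ∈ T, M.factorMsg x i v = ∑ v ∈ T, d v := fun T => by
    simp only [hd, sum_aggregate, sum_subtype_scope]
  have hd0 : ∑ v, d v = 0 := by
    simp only [hd, sum_aggregate, Finset.subtype_univ]
    exact Finset.sum_eq_zero fun i _ => (hx i).2
  have hv : ∀ v, ∑ i, M.factorMsg x i v ^ 2 ≤ 2 * B ^ 2 := by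
    intro v
    set T : Finset V := {w | Relation.TransGen (M.Transfers e x) w v} with hT
    -- A cycle through `v` would give a feasible direction with zero aggregate that correlates
    -- positively with `x`.
    have hvT : v ∉ T := fun hmem => by
      obtain ⟨z, h1, h2, h3⟩ := exists_isFeasible_of_transGen (Finset.mem_filter.1 hmem).2
      exact absurd (hno z h1 (by rw [h3, sub_self])) (not_le.2 h2)
    have h1 := sum_factorMsg_nonpos_of_closed he hx T fun w u hu hwu => by
      rw [hT, Finset.mem_filter] at hu ⊢
      exact ⟨Finset.mem_univ _, Relation.TransGen.head hwu hu.2⟩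
    have h2 := sum_factorMsg_nonpos_of_closed he hx (insert v T) fun w u hu hwu => by
      rw [hT, Finset.mem_insert, Finset.mem_filter] at hu
      rw [hT, Finset.mem_insert, Finset.mem_filter]
      refine Or.inr ⟨Finset.mem_univ _, ?_⟩
      rcases hu with rfl | hu
      · exact Relation.TransGen.single hwu
      · exact Relation.TransGen.head hwu hu.2
    simp only [Finset.sum_insert hvT] at h2
    -- Both `T` and `insert v T` are closed under predecessors, so in each factor the positive part
    -- at `v` is at most minus the sum over `T`. For the negative part, use minus the sum over
    -- `insert v T`.
    have h3 : ∑ i, max (M.factorMsg x i v) 0 ≤ B := by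
      refine le_trans ?_ (neg_sum_le_half_sum_abs d hd0 T)
      rw [← hdT, ← Finset.sum_neg_distrib]
      exact Finset.sum_le_sum fun i _ => max_le (by linarith [h2 i]) (by linarith [h1 i])
    have h4 : ∑ i, max (-M.factorMsg x i v) 0 ≤ B := by
      refine le_trans ?_ (neg_sum_le_half_sum_abs d hd0 (insert v T))
      rw [← hdT, ← Finset.sum_neg_distrib]
      simp only [Finset.sum_insert hvT]
      exact Finset.sum_le_sum fun i _ => max_le (by linarith [h1 i]) (by linarith [h2 i])
    have h5 : ∀ f : ι → ℝ, ∑ i, max (f i) 0 ≤ B → ∑ i, max (f i) 0 ^ 2 ≤ B ^ 2 := fun f hf =>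
      (Finset.sum_sq_le_sq_sum_of_nonneg fun i _ => le_max_right _ _).trans
        (pow_le_pow_left₀ (Finset.sum_nonneg fun i _ => le_max_right _ _) hf 2)
    have h6 := h5 _ h3
    have h7 := h5 _ h4
    calc ∑ i, M.factorMsg x i v ^ 2
        = ∑ i, max (M.factorMsg x i v) 0 ^ 2 + ∑ i, max (-M.factorMsg x i v) 0 ^ 2 := by
          rw [← Finset.sum_add_distrib]
          refine Finset.sum_congr rfl fun i _ => ?_
          rcases le_total (M.factorMsg x i v) 0 with h | h
          · rw [max_eq_right h, max_eq_left (neg_nonneg.2 h)]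
            ring
          · rw [max_eq_left h, max_eq_right (neg_nonpos.2 h)]
            ring
      _ ≤ 2 * B ^ 2 := by linarith
  -- Cauchy–Schwarz costs one factor `|V|`; summing `2 * B ^ 2` over the variables costs the other.
  have hB2 : B ^ 2 ≤ Fintype.card V * ‖M.aggregate x‖ ^ 2 / 4 := by
    have h := sq_sum_le_card_mul_sum_sq (s := Finset.univ) (f := fun v => |d v|)
    simp only [sq_abs] at h
    rw [EuclideanSpace.real_norm_sq_eq, hB, div_pow]
    have : (∑ v, |d v|) ^ 2 ≤ Fintype.card V * ∑ v, M.aggregate x v ^ 2 := h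
    linarith
  rw [norm_sq_eq_sum_factorMsg]
  calc ∑ v, ∑ i, M.factorMsg x i v ^ 2 ≤ ∑ _v : V, 2 * B ^ 2 := Finset.sum_le_sum fun v _ => hv v
    _ = Fintype.card V * (2 * B ^ 2) := by simp
    _ ≤ Fintype.card V * (2 * (Fintype.card V * ‖M.aggregate x‖ ^ 2 / 4)) := by gcongr
    _ = _ := by ring

/-- Error bound: a point of the product of base polytopes is as close to the optimal stacked
vectors as its aggregate is to the optimal aggregate, up to a factor. -/
theorem IsOptimal.norm_sub_sq_le {q e : M.EdgeVec} (hq : q ∈ M.prodBase) (he : M.IsOptimal e)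
    (hnear : ∀ y, M.IsOptimal y → ‖e - q‖ ≤ ‖y - q‖) :
    ‖q - e‖ ^ 2 ≤ (Fintype.card V : ℝ) ^ 2 / 2 * ‖M.aggregate (q - e)‖ ^ 2 := by
  refine norm_sq_le_of_forall_inner_nonpos he.1 (isFeasible_sub he.1 hq) fun z hz hz0 => ?_
  obtain ⟨ε, hε, hmem⟩ := hz.exists_mem he.1
  -- A feasible direction with zero aggregate stays in the optimal set, so the nearest-point
  -- inequality at `e` applies to it.
  have hopt : M.IsOptimal (e + ε • z) := he.of_aggregate_eq hmem (by
    rw [aggregate_add, aggregate_smul, hz0, smul_zero, add_zero])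
  have h : inner ℝ (q - e) (e + ε • z - e) ≤ 0 := inner_sub_nonpos_of_forall_norm_le
    (K := {p | M.IsOptimal p}) (convex_setOf_isOptimal (M := M)) he hnear hopt
  rw [add_sub_cancel_left, real_inner_smul_right] at h
  exact nonpos_of_mul_nonpos_right h hε

end FactorModel

/-! ### Message passing as alternating projection and as block coordinate descent -/

namespace FactorModel

variable {V ι : Type*} [Fintype V] [DecidableEq V] [Fintype ι] {M : FactorModel V ι} {Δ : ℕ}

variable (M) in
/-- `p` is the Euclidean projection of `x` to the product of base polytopes. -/
def IsProjection (x p : M.EdgeVec) : Prop :=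
  p ∈ M.prodBase ∧ ∀ y ∈ M.prodBase, ‖p - x‖ ≤ ‖y - x‖

variable (M) in
theorem existsUnique_isProjection (x : M.EdgeVec) : ∃! p, M.IsProjection x p := by
  obtain ⟨p, hp, hmin⟩ := M.isCompact_prodBase.exists_isMinOn M.prodBase_nonempty
    (f := fun p => ‖p - x‖) (by fun_prop)
  exact ⟨p, ⟨hp, fun y hy => hmin hy⟩, fun y hy =>
    eq_of_forall_norm_le M.convex_prodBase hy.1 hp hy.2 fun y hy => hmin hy⟩

/-- The projection of a stacked vector decouples into the projections of its blocks. -/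
theorem isProjection_iff (hreg : ∀ v, (M.nbrs v).card = Δ) (hΔ : 0 < Δ) {x p : M.EdgeVec}
    (hp : p ∈ M.prodBase) : M.IsProjection x p ↔ ∀ i, IsMinOn
      (fun r : M.scope i → ℝ => M.gStarSq i (fun v => r v - M.block x i v))
      (basePolytope (M.F i)) (M.block p i) := by
  classical
  have hΔ' : (0 : ℝ) < Δ := by positivity
  have hsum : ∀ y : M.EdgeVec,
      (Δ : ℝ) * ‖y - x‖ ^ 2 = ∑ i, M.gStarSq i fun v => M.block y i v - M.block x i v :=
    fun y => (sum_gStarSq_block hreg (y - x)).symm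
  constructor
  · intro h i r hr
    -- A competitor that differs from `p` only in block `i` isolates the `i`-th summand of the
    -- squared distance.
    have hmem : (WithLp.toLp 2 fun e : M.Edge => Function.update (M.block p) i r e.1 e.2 :
        M.EdgeVec) ∈ M.prodBase := by
      intro j
      by_cases hj : j = i
      · subst hj
        have : M.block (WithLp.toLp 2 fun e : M.Edge =>
            Function.update (M.block p) j r e.1 e.2) j = r := by
          ext v
          simp [block]
        rwa [this]
      · have : M.block (WithLp.toLp 2 fun e : M.Edge =>
            Function.update (M.block p) i r e.1 e.2) j = M.block p j := by
          ext v
          simp [block, Function.update_of_ne hj]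
        rw [this]
        exact hp j
    have h1 := mul_le_mul_of_nonneg_left (pow_le_pow_left₀ (norm_nonneg _) (h.2 _ hmem) 2) hΔ'.le
    rw [hsum, hsum, ← Finset.add_sum_erase _ _ (Finset.mem_univ i),
      ← Finset.add_sum_erase Finset.univ (fun j => M.gStarSq j fun v =>
        M.block (WithLp.toLp 2 fun e : M.Edge => Function.update (M.block p) i r e.1 e.2) j v -
          M.block x j v) (Finset.mem_univ i)] at h1
    have h2 : ∀ j ∈ Finset.univ.erase i, (M.gStarSq j fun v =>
        M.block (WithLp.toLp 2 fun e : M.Edge => Function.update (M.block p) i r e.1 e.2) j v -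
          M.block x j v) = M.gStarSq j fun v => M.block p j v - M.block x j v := fun j hj => by
      congr 1
      ext v
      simp [block, Function.update_of_ne (Finset.ne_of_mem_erase hj)]
    rw [Finset.sum_congr rfl h2] at h1
    have h3 := le_of_add_le_add_right h1
    have h4 : (fun v => M.block (WithLp.toLp 2 fun e : M.Edge =>
        Function.update (M.block p) i r e.1 e.2) i v - M.block x i v) =
          fun v => r v - M.block x i v := by
      ext v
      simp [block]
    rwa [h4] at h3
  · intro h
    refine ⟨hp, fun y hy => le_of_sq_le_sq ?_ (norm_nonneg _)⟩
    refine le_of_mul_le_mul_left ?_ hΔ'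
    rw [hsum, hsum]
    exact Finset.sum_le_sum fun i _ => h i (hy i)

theorem isMessagePassing_iff (hreg : ∀ v, (M.nbrs v).card = Δ) (hΔ : 0 < Δ)
    {q : ℕ → M.EdgeVec} : M.IsMessagePassing q ↔
      (∀ t, q t ∈ M.prodBase) ∧ ∀ t, M.IsProjection (M.centered (q t)) (q (t + 1)) := by
  refine and_congr_right fun hq => forall_congr' fun t => ?_
  rw [isProjection_iff hreg hΔ (hq (t + 1))]
  rfl

theorem existsUnique_isMessagePassing (hreg : ∀ v, (M.nbrs v).card = Δ) (hΔ : 0 < Δ)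
    {q₀ : M.EdgeVec} (hq₀ : q₀ ∈ M.prodBase) :
    ∃! q : ℕ → M.EdgeVec, M.IsMessagePassing q ∧ q 0 = q₀ := by
  choose P hP hP' using M.existsUnique_isProjection
  refine ⟨fun t => (fun y => P (M.centered y))^[t] q₀, ⟨?_, rfl⟩, ?_⟩
  · rw [isMessagePassing_iff hreg hΔ]
    have h : ∀ t, M.IsProjection (M.centered ((fun y => P (M.centered y))^[t] q₀))
        ((fun y => P (M.centered y))^[t + 1] q₀) := fun t => by
      rw [Function.iterate_succ_apply']
      exact hP _
    refine ⟨fun t => ?_, h⟩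
    cases t with
    | zero => exact hq₀
    | succ t => exact (h t).1
  · rintro q ⟨hq, hq0⟩
    rw [isMessagePassing_iff hreg hΔ] at hq
    ext1 t
    induction t with
    | zero => exact hq0
    | succ t ih =>
      simp only [Function.iterate_succ_apply'] at ih ⊢
      rw [← ih]
      exact hP' _ _ (hq.2 t)

/-- By Pythagoras the objective is, on the multipliers, a constant minus a positive multiple of the
squared distance to `centered y`. -/
theorem isMaxOn_dualObjective_left_iff (hreg : ∀ v, (M.nbrs v).card = Δ) (hΔ : 0 < Δ)
    {l y : M.EdgeVec} (hl : l ∈ M.multipliers) :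
    IsMaxOn (fun l' => M.dualObjective l' y) M.multipliers l ↔ l = M.centered y := by
  have hΔ' : (0 : ℝ) < Δ := by positivity
  have hc : M.centered y ∈ M.multipliers := mem_multipliers.2 (aggregate_centered hreg hΔ y)
  have hval : ∀ l' ∈ M.multipliers, M.dualObjective l' y =
      -(1 / 2) * (Δ * (‖M.aggregate y‖ ^ 2 / Δ + ‖M.centered y - l'‖ ^ 2)) := fun l' hl' => by
    rw [dualObjective_eq hreg, norm_sub_sq_of_mem_multipliers hreg hΔ y hl']
  constructor
  · intro h
    have h1 : M.dualObjective (M.centered y) y ≤ M.dualObjective l y := h hc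
    rw [hval _ hc, hval _ hl, sub_self, norm_zero] at h1
    have h2 : Δ * ‖M.centered y - l‖ ^ 2 ≤ 0 := by linarith
    have h3 : ‖M.centered y - l‖ ^ 2 = 0 :=
      le_antisymm (nonpos_of_mul_nonpos_right h2 hΔ') (sq_nonneg _)
    exact (sub_eq_zero.1 (norm_eq_zero.1 (pow_eq_zero_iff two_ne_zero |>.1 h3))).symm
  · rintro rfl l' hl'
    change M.dualObjective l' y ≤ M.dualObjective (M.centered y) y
    rw [hval _ hc, hval _ hl', sub_self, norm_zero]
    have := mul_nonneg hΔ'.le (sq_nonneg ‖M.centered y - l'‖)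
    linarith

theorem isMaxOn_dualObjective_right_iff (hreg : ∀ v, (M.nbrs v).card = Δ) (hΔ : 0 < Δ)
    {l y : M.EdgeVec} (hy : y ∈ M.prodBase) :
    IsMaxOn (fun y' => M.dualObjective l y') M.prodBase y ↔ M.IsProjection l y := by
  have hΔ' : (0 : ℝ) < Δ := by positivity
  refine ⟨fun h => ⟨hy, fun z hz => ?_⟩, fun h z hz => ?_⟩
  · have h1 : M.dualObjective l z ≤ M.dualObjective l y := h hz
    rw [dualObjective_eq hreg, dualObjective_eq hreg] at h1
    exact le_of_sq_le_sq (le_of_mul_le_mul_left (by linarith) hΔ') (norm_nonneg _)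
  · change M.dualObjective l z ≤ M.dualObjective l y
    rw [dualObjective_eq hreg, dualObjective_eq hreg]
    have h1 := mul_le_mul_of_nonneg_left (pow_le_pow_left₀ (norm_nonneg _) (h.2 z hz) 2) hΔ'.le
    linarith

theorem isMessagePassing_iff_exists_isBlockCoordinateDescent (hreg : ∀ v, (M.nbrs v).card = Δ)
    (hΔ : 0 < Δ) (q : ℕ → M.EdgeVec) :
    M.IsMessagePassing q ↔ ∃ l : ℕ → M.EdgeVec, M.IsBlockCoordinateDescent l q := by
  rw [isMessagePassing_iff hreg hΔ]
  constructor
  · rintro ⟨hq, h⟩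
    have hc : ∀ t, M.centered (q t) ∈ M.multipliers := fun t =>
      mem_multipliers.2 (aggregate_centered hreg hΔ (q t))
    exact ⟨fun t => M.centered (q t), hq, hc,
      fun t => (isMaxOn_dualObjective_left_iff hreg hΔ (hc t)).2 rfl,
      fun t => (isMaxOn_dualObjective_right_iff hreg hΔ (hq (t + 1))).2 (h t)⟩
  · rintro ⟨l, hq, hl, h1, h2⟩
    refine ⟨hq, fun t => ?_⟩
    rw [← (isMaxOn_dualObjective_left_iff hreg hΔ (hl t)).1 (h1 t)]
    exact (isMaxOn_dualObjective_right_iff hreg hΔ (hq (t + 1))).1 (h2 t)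

/-! ### Contraction and linear convergence -/

/-- One round decreases the distance to every optimal stacked vector. -/
theorem IsProjection.norm_sub_sq_le (hreg : ∀ v, (M.nbrs v).card = Δ) (hΔ : 0 < Δ)
    {q q' e : M.EdgeVec} (h : M.IsProjection (M.centered q) q') (he : M.IsOptimal e) :
    ‖q' - e‖ ^ 2 ≤ ‖q - e‖ ^ 2 - ‖M.aggregate (q - e)‖ ^ 2 / Δ := by
  have h1 := inner_sub_nonpos_of_forall_norm_le M.convex_prodBase h.1 h.2 he.1
  have h2 := mul_nonneg (inv_nonneg.2 (Nat.cast_nonneg (α := ℝ) Δ)) (he.inner_nonneg h.1)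
  rw [← inner_lift, ← real_inner_smul_left] at h2
  have h3 : (Δ : ℝ)⁻¹ • M.lift (M.aggregate e) = e - M.centered e := by
    rw [centered_eq hreg]
    abel
  rw [h3] at h2
  -- The sum of the variational inequality of the projection `q'` and the optimality of `e`. It
  -- yields `‖q' - e‖ ≤ ‖centered (q - e)‖`, and `h7` evaluates the right side.
  have h4 : 0 ≤ inner ℝ (M.centered (q - e) - (q' - e)) (q' - e) := by
    have h5 : inner ℝ (M.centered (q - e) - (q' - e)) (q' - e) =
        inner ℝ (e - M.centered e) (q' - e) - inner ℝ (M.centered q - q') (e - q') := by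
      rw [← neg_sub q' e, inner_neg_right, sub_neg_eq_add, ← inner_add_left, centered_sub hreg]
      congr 1
      abel
    rw [h5]
    linarith
  have h6 := norm_add_sq_real (M.centered (q - e) - (q' - e)) (q' - e)
  rw [sub_add_cancel] at h6
  have h7 := norm_sq_eq_centered hreg hΔ (q - e)
  have := sq_nonneg ‖M.centered (q - e) - (q' - e)‖
  linarith

variable (Δ) in
/-- The contraction factor of one round of message passing. -/
noncomputable def rate : ℝ := 1 - 1 / ((Fintype.card V : ℝ) ^ 2 * (Δ : ℝ) ^ 2)

theorem rate_nonneg [Nonempty V] (hΔ : 0 < Δ) : 0 ≤ rate (V := V) Δ := by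
  have h1 : (1 : ℝ) ≤ Fintype.card V := by exact_mod_cast Fintype.card_pos
  have h2 : (1 : ℝ) ≤ Δ := by exact_mod_cast hΔ
  rw [rate, sub_nonneg, div_le_one (by positivity)]
  exact one_le_mul_of_one_le_of_one_le (one_le_pow₀ h1) (one_le_pow₀ h2)

theorem rate_lt_one [Nonempty V] (hΔ : 0 < Δ) : rate (V := V) Δ < 1 := by
  have h1 : (0 : ℝ) < Fintype.card V := by exact_mod_cast Fintype.card_pos
  have h2 : (0 : ℝ) < Δ := by exact_mod_cast hΔ
  rw [rate, sub_lt_self_iff]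
  positivity

/-- One round contracts the distance to the nearest optimal stacked vector. -/
theorem IsProjection.norm_sub_le_rate [Nonempty V] (hreg : ∀ v, (M.nbrs v).card = Δ) (hΔ : 0 < Δ)
    {q q' e : M.EdgeVec} (hq : q ∈ M.prodBase) (h : M.IsProjection (M.centered q) q')
    (he : M.IsOptimal e) (hnear : ∀ y, M.IsOptimal y → ‖e - q‖ ≤ ‖y - q‖) :
    ‖q' - e‖ ≤ rate (V := V) Δ * ‖q - e‖ := by
  refine le_of_sq_le_sq ?_ (mul_nonneg (rate_nonneg hΔ) (norm_nonneg _))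
  have h1 : (1 : ℝ) ≤ Fintype.card V := by exact_mod_cast Fintype.card_pos
  have h2 : (1 : ℝ) ≤ Δ := by exact_mod_cast hΔ
  have h3 := h.norm_sub_sq_le hreg hΔ he
  have h4 := IsOptimal.norm_sub_sq_le hq he hnear
  rw [rate]
  set N : ℝ := (Fintype.card V : ℝ)
  set z : ℝ := 1 / (N ^ 2 * (Δ : ℝ) ^ 2) with hz
  -- The error bound would even allow `Δ` in place of `Δ ^ 2` in `z`; the weaker constant is the one
  -- in the stated rate.
  have h5 : 2 * z * ‖q - e‖ ^ 2 ≤ ‖M.aggregate (q - e)‖ ^ 2 / Δ := by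
    calc 2 * z * ‖q - e‖ ^ 2 ≤ 2 * z * (N ^ 2 / 2 * ‖M.aggregate (q - e)‖ ^ 2) := by gcongr
      _ = ‖M.aggregate (q - e)‖ ^ 2 / (Δ : ℝ) ^ 2 := by
        rw [hz]
        field_simp
      _ ≤ ‖M.aggregate (q - e)‖ ^ 2 / Δ := by
        gcongr
        exact le_self_pow₀ h2 two_ne_zero
  -- The squared distance shrinks by `1 - 2 * z ≤ (1 - z) ^ 2`.
  have h6 : ((1 - z) * ‖q - e‖) ^ 2 = ‖q - e‖ ^ 2 - 2 * z * ‖q - e‖ ^ 2 + (z * ‖q - e‖) ^ 2 := by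
    ring
  have := sq_nonneg (z * ‖q - e‖)
  linarith

theorem norm_le_sqrt_mul_supNorm (y : M.EdgeVec) :
    ‖y‖ ≤ Real.sqrt M.numEdges * M.supNorm y := by
  refine le_of_sq_le_sq ?_ (mul_nonneg (Real.sqrt_nonneg _) (norm_nonneg _))
  rw [mul_pow, Real.sq_sqrt (Nat.cast_nonneg _), EuclideanSpace.real_norm_sq_eq]
  calc ∑ e, y e ^ 2 ≤ ∑ _e : M.Edge, M.supNorm y ^ 2 := Finset.sum_le_sum fun e _ => by
        rw [← sq_abs]
        exact pow_le_pow_left₀ (abs_nonneg _) (norm_le_pi_norm (WithLp.ofLp y) e) 2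
    _ = M.numEdges * M.supNorm y ^ 2 := by simp [numEdges]

variable (M) in
theorem exists_nearest_isOptimal (q : M.EdgeVec) :
    ∃ e, M.IsOptimal e ∧ ∀ y, M.IsOptimal y → ‖e - q‖ ≤ ‖y - q‖ := by
  have hc : IsCompact {p | M.IsOptimal p} :=
    M.isCompact_prodBase.of_isClosed_subset isClosed_setOf_isOptimal fun p hp => hp.1
  obtain ⟨e, he, hmin⟩ := hc.exists_isMinOn M.exists_isOptimal
    (f := fun p => ‖p - q‖) (by fun_prop)
  exact ⟨e, he, fun y hy => hmin hy⟩

/-- The distance of the iterates to the optimal stacked vectors decreases geometrically. -/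
theorem IsMessagePassing.exists_isOptimal_norm_sub_le [Nonempty V]
    (hreg : ∀ v, (M.nbrs v).card = Δ) (hΔ : 0 < Δ) {q : ℕ → M.EdgeVec}
    (hq : M.IsMessagePassing q) (t : ℕ) : ∃ e, M.IsOptimal e ∧
      ∀ p, M.IsOptimal p → ‖q t - e‖ ≤ ‖q 0 - p‖ * rate (V := V) Δ ^ t := by
  rw [isMessagePassing_iff hreg hΔ] at hq
  induction t with
  | zero =>
    obtain ⟨e, he, hnear⟩ := M.exists_nearest_isOptimal (q 0)
    refine ⟨e, he, fun p hp => ?_⟩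
    rw [pow_zero, mul_one, norm_sub_rev, norm_sub_rev _ p]
    exact hnear p hp
  | succ t ih =>
    obtain ⟨e', he', h'⟩ := ih
    obtain ⟨e, he, hnear⟩ := M.exists_nearest_isOptimal (q t)
    refine ⟨e, he, fun p hp => ?_⟩
    have h1 := (hq.2 t).norm_sub_le_rate hreg hΔ (hq.1 t) he hnear
    have h2 : ‖q t - e‖ ≤ ‖q t - e'‖ := by
      rw [norm_sub_rev, norm_sub_rev _ e']
      exact hnear e' he'
    refine h1.trans ((mul_le_mul_of_nonneg_left (h2.trans (h' p hp)) (rate_nonneg hΔ)).trans_eq ?_)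
    ring

theorem IsMessagePassing.norm_sub_antitone (hreg : ∀ v, (M.nbrs v).card = Δ) (hΔ : 0 < Δ)
    {q : ℕ → M.EdgeVec} (hq : M.IsMessagePassing q) {e : M.EdgeVec} (he : M.IsOptimal e) :
    Antitone fun t => ‖q t - e‖ := by
  rw [isMessagePassing_iff hreg hΔ] at hq
  refine antitone_nat_of_succ_le fun t => le_of_sq_le_sq ?_ (norm_nonneg _)
  have h := (hq.2 t).norm_sub_sq_le hreg hΔ he
  have : 0 ≤ ‖M.aggregate (q t - e)‖ ^ 2 / Δ := by positivity
  linarith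

/-- Linear convergence of the stacked iterates. -/
theorem IsMessagePassing.exists_tendsto [Nonempty V]
    (hreg : ∀ v, (M.nbrs v).card = Δ) (hΔ : 0 < Δ) {q : ℕ → M.EdgeVec}
    (hq : M.IsMessagePassing q) : ∃ qStar, M.IsOptimal qStar ∧ Tendsto q atTop (𝓝 qStar) ∧
      ∀ t, ‖q t - qStar‖ ≤ 2 * (‖q 0 - qStar‖ * rate (V := V) Δ ^ t) := by
  choose e he hle using hq.exists_isOptimal_norm_sub_le hreg hΔ
  -- Every later iterate is at least as close to `e t` as `q t` is; the triangle inequality through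
  -- `e t` produces the factor 2.
  have hdist : ∀ p, M.IsOptimal p → ∀ t s, t ≤ s →
      ‖q t - q s‖ ≤ 2 * (‖q 0 - p‖ * rate (V := V) Δ ^ t) := fun p hp t s hts => by
    have h1 := hle t p hp
    have h2 : ‖q s - e t‖ ≤ ‖q t - e t‖ := hq.norm_sub_antitone hreg hΔ (he t) hts
    have h3 := norm_sub_le (q t - e t) (q s - e t)
    rw [sub_sub_sub_cancel_right] at h3
    linarith
  have hpow : Tendsto (fun t => rate (V := V) Δ ^ t) atTop (𝓝 0) :=
    tendsto_pow_atTop_nhds_zero_of_lt_one (rate_nonneg hΔ) (rate_lt_one hΔ)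
  have hzero : ∀ c : ℝ, Tendsto (fun t => c * rate (V := V) Δ ^ t) atTop (𝓝 0) := fun c => by
    simpa using hpow.const_mul c
  obtain ⟨p, hp⟩ := M.exists_isOptimal
  have hcauchy : CauchySeq q := by
    refine cauchySeq_of_le_tendsto_0' (fun t => 2 * (‖q 0 - p‖ * rate (V := V) Δ ^ t))
      (fun t s hts => ?_) (by simpa using (hzero ‖q 0 - p‖).const_mul 2)
    rw [dist_eq_norm]
    exact hdist p hp t s hts
  obtain ⟨qStar, hlim⟩ := cauchySeq_tendsto_of_complete hcauchy
  have hdiff : Tendsto (fun t => q t - e t) atTop (𝓝 0) :=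
    squeeze_zero_norm (fun t => hle t p hp) (hzero _)
  have hopt : M.IsOptimal qStar := isClosed_setOf_isOptimal.mem_of_tendsto
    (by simpa using hlim.sub hdiff : Tendsto e atTop (𝓝 qStar)) (Eventually.of_forall he)
  refine ⟨qStar, hopt, hlim, fun t => ?_⟩
  exact le_of_tendsto ((tendsto_const_nhds.sub hlim).norm)
    ((eventually_ge_atTop t).mono fun s hs => hdist qStar hopt t s hs)

/-- Linear convergence of the aggregated iterates. -/
theorem IsMessagePassing.norm_aggregate_sub_le [Nonempty V]
    (hreg : ∀ v, (M.nbrs v).card = Δ) (hΔ : 0 < Δ) {q : ℕ → M.EdgeVec}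
    (hq : M.IsMessagePassing q) {s : EuclideanSpace ℝ V} (hs : M.IsMinNormPoint s)
    {p : M.EdgeVec} (hp : M.IsOptimal p) (t : ℕ) :
    ‖M.aggregate (q t) - s‖ ≤ Real.sqrt Δ * (‖q 0 - p‖ * rate (V := V) Δ ^ t) := by
  obtain ⟨e, he, hle⟩ := hq.exists_isOptimal_norm_sub_le hreg hΔ t
  rw [hs.eq he.isMinNormPoint, ← aggregate_sub]
  exact (norm_aggregate_le hreg hΔ _).trans
    (mul_le_mul_of_nonneg_left (hle p hp) (Real.sqrt_nonneg _))

end FactorModel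

/-! ### The stated constants and the theorem -/

namespace FactorModel

theorem messagePassing_convergence {V ι : Type*} [Fintype V] [DecidableEq V] [Fintype ι]
    (M : FactorModel V ι) {Δ : ℕ} (hreg : ∀ v, (M.nbrs v).card = Δ) (hΔ : 0 < Δ)
    (q : ℕ → M.EdgeVec) (hq : M.IsMessagePassing q) :
    (∃ qStar : M.EdgeVec, M.IsOptimal qStar ∧ Tendsto q atTop (𝓝 qStar) ∧
      ∀ t : ℕ, ‖q t - qStar‖ ≤
        2 * M.supNorm (q 0 - qStar) * Real.sqrt ((Δ : ℝ) * (M.numEdges : ℝ)) *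
          (1 - 1 / ((Fintype.card V : ℝ) ^ 2 * (Δ : ℝ) ^ 2)) ^ t) ∧
    ∀ s : EuclideanSpace ℝ V, M.IsMinNormPoint s → ∀ p : M.EdgeVec, M.IsOptimal p →
      ∀ t : ℕ, ‖M.aggregate (q t) - s‖ ≤
        2 * M.supNorm (q 0 - p) * Real.sqrt ((Δ : ℝ) * (M.numEdges : ℝ)) *
          (1 - 1 / ((Fintype.card V : ℝ) ^ 2 * (Δ : ℝ) ^ 2)) ^ t := by
  rcases isEmpty_or_nonempty V with hV | hV
  · have : IsEmpty M.Edge := ⟨fun e => hV.false e.2⟩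
    have hE : M.numEdges = 0 := Fintype.card_eq_zero
    obtain ⟨p, hp⟩ := M.exists_isOptimal
    refine ⟨⟨p, hp, ?_, fun t => ?_⟩, fun s _ p _ t => ?_⟩
    · rw [Subsingleton.elim q fun _ => p]
      exact tendsto_const_nhds
    · simp [hE, Subsingleton.elim (q t) p]
    · simp [hE, Subsingleton.elim (M.aggregate (q t)) s]
  have hr (t : ℕ) : 0 ≤ rate (V := V) Δ ^ t := pow_nonneg (rate_nonneg hΔ) t
  have hsqrt : (1 : ℝ) ≤ Real.sqrt Δ := Real.one_le_sqrt.2 (by exact_mod_cast hΔ)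
  have key : ∀ y : M.EdgeVec, ∀ t : ℕ, Real.sqrt Δ * (‖y‖ * rate (V := V) Δ ^ t) ≤
      M.supNorm y * Real.sqrt ((Δ : ℝ) * (M.numEdges : ℝ)) * rate (V := V) Δ ^ t := by
    intro y t
    rw [Real.sqrt_mul (Nat.cast_nonneg _), ← mul_assoc]
    refine mul_le_mul_of_nonneg_right ?_ (hr t)
    refine (mul_le_mul_of_nonneg_left (norm_le_sqrt_mul_supNorm y) (Real.sqrt_nonneg _)).trans_eq ?_
    ring
  constructor
  · obtain ⟨qStar, hopt, hlim, hle⟩ := hq.exists_tendsto hreg hΔ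
    refine ⟨qStar, hopt, hlim, fun t => (hle t).trans ?_⟩
    have h1 := key (q 0 - qStar) t
    -- For the stacked iterates the factor `√Δ ≥ 1` is slack; for the aggregates it is the norm of
    -- aggregation, and there the factor 2 is slack.
    have h2 := le_mul_of_one_le_left (mul_nonneg (norm_nonneg (q 0 - qStar)) (hr t)) hsqrt
    change _ ≤ 2 * _ * _ * rate (V := V) Δ ^ t
    linarith
  · intro s hs p hp t
    refine (hq.norm_aggregate_sub_le hreg hΔ hs hp t).trans ?_
    have h1 := key (q 0 - p) t
    have h2 : 0 ≤ Real.sqrt Δ * (‖q 0 - p‖ * rate (V := V) Δ ^ t) :=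
      mul_nonneg (Real.sqrt_nonneg _) (mul_nonneg (norm_nonneg _) (hr t))
    change _ ≤ 2 * _ * _ * rate (V := V) Δ ^ t
    linarith

end FactorModel

theorem mainTheorem6 {V ι : Type*} [Fintype V] [DecidableEq V] [Fintype ι]
    (M : FactorModel V ι) (Δ : ℕ) (hreg : ∀ v, (M.nbrs v).card = Δ) :
    -- the algorithm is well defined from every starting point
    (∀ q₀ ∈ M.prodBase, ∃! q : ℕ → M.EdgeVec, M.IsMessagePassing q ∧ q 0 = q₀) ∧
    -- it is block coordinate descent on the decomposed dual
    (∀ q : ℕ → M.EdgeVec,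
      M.IsMessagePassing q ↔ ∃ l : ℕ → M.EdgeVec, M.IsBlockCoordinateDescent l q) ∧
    -- there is exactly one min-norm point, the aggregate of every optimal stacked vector
    (∃! s : EuclideanSpace ℝ V, M.IsMinNormPoint s) ∧
    (∀ p : M.EdgeVec, M.IsOptimal p → M.IsMinNormPoint (M.aggregate p)) ∧
    ∀ q : ℕ → M.EdgeVec, M.IsMessagePassing q →
      -- linear convergence of the stacked iterates to an optimal stacked vector
      (∃ qStar : M.EdgeVec, M.IsOptimal qStar ∧ Tendsto q atTop (𝓝 qStar) ∧
        ∀ t : ℕ, ‖q t - qStar‖ ≤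
          2 * M.supNorm (q 0 - qStar) * Real.sqrt ((Δ : ℝ) * (M.numEdges : ℝ)) *
            (1 - 1 / ((Fintype.card V : ℝ) ^ 2 * (Δ : ℝ) ^ 2)) ^ t) ∧
      -- linear convergence of the aggregated iterates to the min-norm point
      ∀ s : EuclideanSpace ℝ V, M.IsMinNormPoint s → ∀ p : M.EdgeVec, M.IsOptimal p →
        ∀ t : ℕ, ‖M.aggregate (q t) - s‖ ≤
          2 * M.supNorm (q 0 - p) * Real.sqrt ((Δ : ℝ) * (M.numEdges : ℝ)) *
            (1 - 1 / ((Fintype.card V : ℝ) ^ 2 * (Δ : ℝ) ^ 2)) ^ t := by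
  -- a degree can be zero only if there are no variables; then every degree is admissible
  obtain ⟨Δ', hreg', hpos, hΔ⟩ : ∃ Δ' : ℕ, (∀ v, (M.nbrs v).card = Δ') ∧ 0 < Δ' ∧
      (Δ' = Δ ∨ IsEmpty V) := by
    rcases isEmpty_or_nonempty V with hV | ⟨⟨v⟩⟩
    · exact ⟨1, fun v => (hV.false v).elim, one_pos, Or.inr hV⟩
    · refine ⟨Δ, hreg, ?_, Or.inl rfl⟩
      obtain ⟨i, hi⟩ := M.cover v
      rw [← hreg v]
      exact Finset.card_pos.2 ⟨i, by simpa [FactorModel.nbrs] using hi⟩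
  obtain ⟨p, hp⟩ := M.exists_isOptimal
  refine ⟨fun _ h => FactorModel.existsUnique_isMessagePassing hreg' hpos h,
    FactorModel.isMessagePassing_iff_exists_isBlockCoordinateDescent hreg' hpos,
    ⟨_, hp.isMinNormPoint, fun s hs => hs.eq hp.isMinNormPoint⟩,
    fun p hp => hp.isMinNormPoint, fun q hq => ?_⟩
  have h := M.messagePassing_convergence hreg' hpos q hq
  rcases hΔ with rfl | hV
  · exact h
  · have : IsEmpty M.Edge := ⟨fun e => hV.false e.2⟩
    have hE : M.numEdges = 0 := Fintype.card_eq_zero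
    -- Without variables there are no edges, so both bounds vanish whatever the degree.
    simpa [hE] using h
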